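/- Let $b\in H^\infty$ be a non-extreme point of the closed unit ball of $H^\infty$ (on the open unit disk $\mathbb D$), and let $a\in H^\infty$ be the outer function with $a(0)>0$ and $|a|^2+|b|^2=1$ a.e. on the unit circle. For $\phi\in L^\infty$ of the circle let $T_\phi g=P_+(\phi g)$ be the Toeplitz operator on $H^2$, where $P_+$ is the orthogonal projection of $L^2$ onto $H^2$, and let $\mathcal H(b)=(I-T_bT_{\bar b})^{1/2}H^2$ be the de Branges–Rovnyak space. For $g\in\mathcal H(b)$, let $g^+$ denote the unique element of $H^2$ with $T_{\bar b}g=T_{\bar a}g^+$. For $f(z)=\sum_{n\ge0}a_nz^n$ put $s_n[f](z)=\sum_{k=0}^na_kz^k$, $f_t(z)=\sum_{n\ge0}a_nt^nz^n$ for $0\le t<1$, and $$L_r[f](z)=\frac{r}{\log\frac1{1-r}}\sum_{n\ge0}\frac{s_n[f](z)}{n+1}\,r^n\qquad(0<r<1,\ z\in\mathbb D).$$ Let $f\in\mathcal H(b)$ and $r\in(0,1)$. Then the series defining $L_r[f]$ converges on $\mathbb D$; the functions $f_t$ $(0\le t\le r)$ and $L_r[f]$ belong to $\mathcal H(b)$,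 and $(f_t)^+$ and $(L_r[f])^+$ exist and are unique; the map $t\mapsto (f_t)^+/(1-t)$ is Bochner integrable from $[0,r]$ into $H^2$; and $$(L_r[f])^+=\frac1{\log\frac1{1-r}}\int_0^r\frac{(f_t)^+}{1-t}\,dt,$$ where the integral is an $H^2$-valued Bochner integral. -/

import Mathlib

open MeasureTheory Set
open scoped ENNReal ComplexConjugate

noncomputable section

namespace DeBrangesRovnyak

/-- The unit circle, parametrised by `x ↦ exp (2 π i x)`, `x ∈ ℝ / ℤ`. The function `z ^ n` on the
circle is `fourier n`, and normalised arc length is `AddCircle.haarAddCircle`. -/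
abbrev Torus : Type := UnitAddCircle

/-- Normalised Lebesgue measure on the circle. -/
abbrev arc : Measure Torus := AddCircle.haarAddCircle

theorem integrable_of_Lp {p : ℝ≥0∞} [hp : Fact (1 ≤ p)] (f : Lp ℂ p arc) : Integrable f arc :=
  memLp_one_iff_integrable.1 ((Lp.memLp f).mono_exponent hp.out)

/-- The Hardy subspace of `L^p` of the circle: the functions whose Fourier coefficients of negative
index all vanish. -/
def hardy (p : ℝ≥0∞) [Fact (1 ≤ p)] : Submodule ℂ (Lp ℂ p arc) where
  carrier := {f | ∀ n : ℤ, n < 0 → fourierCoeff f n = 0}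
  zero_mem' := by
    intro n _
    rw [fourierCoeff_congr_ae (Lp.coeFn_zero ℂ p arc)]
    simp [fourierCoeff]
  add_mem' := by
    intro f g hf hg n hn
    rw [fourierCoeff_congr_ae (Lp.coeFn_add f g),
      fourierCoeff.add (integrable_of_Lp f) (integrable_of_Lp g), Pi.add_apply, hf n hn, hg n hn,
      add_zero]
  smul_mem' := by
    intro c f hf n hn
    rw [fourierCoeff_congr_ae (Lp.coeFn_smul c f), fourierCoeff.const_smul, hf n hn, smul_zero]

/-- The space `H^∞`, as a subspace of `L^∞` of the circle, with the supremum norm. -/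
abbrev Hinf : Submodule ℂ (Lp ℂ ∞ arc) := hardy ∞

theorem isClosed_hardy_two : IsClosed (hardy 2 : Set (Lp ℂ 2 arc)) := by
  have h : (hardy 2 : Set (Lp ℂ 2 arc)) =
      ⋂ (n : ℤ) (_ : n < 0), {f | fourierBasis.repr f n = 0} := by
    ext f
    simp [hardy, fourierBasis_repr]
  rw [h]
  refine isClosed_iInter fun n => isClosed_iInter fun _ => ?_
  have h2 : (fun f : Lp ℂ 2 arc => fourierBasis.repr f n) =
      fun f => inner ℂ (fourierBasis n) f := by
    ext f
    exact fourierBasis.repr_apply_apply f n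
  have h3 : Continuous (fun f : Lp ℂ 2 arc => fourierBasis.repr f n) := by
    rw [h2]
    fun_prop
  exact isClosed_eq h3 continuous_const

/-- The Hardy space `H²`, realised as a closed subspace of `L²` of the circle, with the `L²` inner
product. -/
def H2 : Type := ↥(hardy 2)

instance instNormedAddCommGroupH2 : NormedAddCommGroup H2 :=
  inferInstanceAs (NormedAddCommGroup ↥(hardy 2))

instance instInnerProductSpaceH2 : InnerProductSpace ℂ H2 :=
  inferInstanceAs (InnerProductSpace ℂ ↥(hardy 2))

instance instCompleteSpaceHardyTwo : CompleteSpace ↥(hardy 2) :=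
  isClosed_hardy_two.completeSpace_coe

instance instCompleteSpaceH2 : CompleteSpace H2 :=
  inferInstanceAs (CompleteSpace ↥(hardy 2))

/-- The inclusion of `H²` in `L²` of the circle: an element of `H²` as a boundary function. -/
def H2.incl : H2 →L[ℂ] Lp ℂ 2 arc := (hardy 2).subtypeL

/-- The orthogonal projection `P₊` of `L²` of the circle onto `H²`. -/
def H2.proj : Lp ℂ 2 arc →L[ℂ] H2 := (hardy 2).orthogonalProjectionOnto

/-- The `n`-th Taylor coefficient of the holomorphic function on the unit disk whose boundary
function is `g`. -/
def taylorCoeff (g : Torus → ℂ) (n : ℕ) : ℂ := fourierCoeff g (n : ℤ)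

/-- The value at a point `z` of the unit disk of the holomorphic function with boundary
function `g`. -/
def discValue (g : Torus → ℂ) (z : ℂ) : ℂ := ∑' n : ℕ, taylorCoeff g n * z ^ n

/-- The function `F` on the unit disk belongs to `H²`. -/
def MemH2 (F : ℂ → ℂ) : Prop := ∃ g : H2, ∀ z : ℂ, ‖z‖ < 1 → discValue (H2.incl g) z = F z

/-- The element of `H²` given by a function `F` on the unit disk (meaningful if `MemH2 F`; it is
then unique, since its values on the disk determine its Taylor coefficients). -/
def toH2 (F : ℂ → ℂ) : H2 :=
  Classical.epsilon fun g : H2 => ∀ z : ℂ, ‖z‖ < 1 → discValue (H2.incl g) z = F z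

/-- The Toeplitz operator `T_φ f = P₊ (φ f)` on `H²` with symbol `φ ∈ L^∞`. -/
def toeplitz (φ : Lp ℂ ∞ arc) : H2 →L[ℂ] H2 :=
  H2.proj ∘L ((ContinuousLinearMap.mul ℂ ℂ).holderL arc ∞ 2 2 φ) ∘L H2.incl

/-- The de Branges–Rovnyak space `H(b)`, as a linear subspace of `H²`: the range of
`(I - T_b T_{b̄})^{1/2}`. -/
def Hb (b : Hinf) : Submodule ℂ H2 :=
  LinearMap.range
    ((CFC.sqrt (1 - toeplitz (b : Lp ℂ ∞ arc) * toeplitz (star (b : Lp ℂ ∞ arc))) :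
      H2 →L[ℂ] H2) : H2 →ₗ[ℂ] H2)

/-- `b` is a non-extreme point of the closed unit ball of `H^∞`. -/
def NonExtreme (b : Hinf) : Prop :=
  b ∈ Metric.closedBall (0 : Hinf) 1 ∧ b ∉ extremePoints ℝ (Metric.closedBall (0 : Hinf) 1)

/-- `a ∈ H^∞` is an outer function:
`a(z) = c exp (∫ (ζ + z) / (ζ - z) log |a(ζ)| dm(ζ))` on the unit disk, with `|c| = 1` and
`log |a|` integrable on the circle. -/
structure IsOuter (a : Hinf) : Prop where
  ne_zero : ∀ᵐ x ∂arc, (a : Lp ℂ ∞ arc) x ≠ 0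
  integrable_log : Integrable (fun x => Real.log ‖(a : Lp ℂ ∞ arc) x‖) arc
  eq_exp : ∃ c : ℂ, ‖c‖ = 1 ∧ ∀ z : ℂ, ‖z‖ < 1 →
    discValue (a : Lp ℂ ∞ arc) z = c * Complex.exp
      (∫ x, (fourier 1 x + z) / (fourier 1 x - z) * (Real.log ‖(a : Lp ℂ ∞ arc) x‖ : ℂ) ∂arc)

/-- `(b, a)` is a Pythagorean pair: `a` is outer, `a(0) > 0` and `|a|² + |b|² = 1` a.e. on the
circle. -/
structure IsPythagoreanPair (b a : Hinf) : Prop where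
  outer : IsOuter a
  pos_at_zero : ∃ c : ℝ, 0 < c ∧ discValue (a : Lp ℂ ∞ arc) 0 = (c : ℂ)
  sq_add_sq : ∀ᵐ x ∂arc, ‖(a : Lp ℂ ∞ arc) x‖ ^ 2 + ‖(b : Lp ℂ ∞ arc) x‖ ^ 2 = 1

/-- The equation `T_{b̄} f = T_{ā} g` that defines `g = f⁺`. -/
def IsPlus (b a : Hinf) (f g : H2) : Prop :=
  toeplitz (star (b : Lp ℂ ∞ arc)) f = toeplitz (star (a : Lp ℂ ∞ arc)) g

/-- The function `f⁺` (meaningful if there is exactly one `g` with `IsPlus b a f g`). -/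
def plus (b a : Hinf) (f : H2) : H2 := Classical.epsilon fun g => IsPlus b a f g

/-- The dilate `f_t(z) = ∑ aₙ tⁿ zⁿ` of `f(z) = ∑ aₙ zⁿ`. -/
def dilate (f : H2) (t : ℝ) (z : ℂ) : ℂ := ∑' n : ℕ, taylorCoeff (H2.incl f) n * (t : ℂ) ^ n * z ^ n

/-- The partial sum `sₙ[f](z) = ∑_{k ≤ n} a_k z^k` of the Taylor series of `f`. -/
def partialSum (f : H2) (n : ℕ) (z : ℂ) : ℂ :=
  ∑ k ∈ Finset.range (n + 1), taylorCoeff (H2.incl f) k * z ^ k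

/-- The logarithmic mean
`L_r[f](z) = r / log (1 / (1 - r)) * ∑ₙ sₙ[f](z) / (n + 1) * rⁿ`. -/
def logMean (f : H2) (r : ℝ) (z : ℂ) : ℂ :=
  ((r / Real.log (1 / (1 - r)) : ℝ) : ℂ) *
    ∑' n : ℕ, partialSum f n z / ((n : ℂ) + 1) * (r : ℂ) ^ n

end DeBrangesRovnyak

end

noncomputable section

namespace DeBrangesRovnyak

/-! ### Power series on the unit disk -/

/-! If `f = T_ā q`, then commutation of co-analytic Toeplitz operators gives `T_b̄ f = T_ā (T_b̄
q)`, so `f⁺ = T_b̄ q`. The proof therefore lifts everything through `T_ā`.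

The dilates do lift. On polynomials `T_ā` is triangular, and since the outer function `a` has no
zeros, the Taylor coefficients of `1/a` provide polynomials `q_n` with `T_ā q_n = z^n`. As `1/a` is
analytic on the whole disk, `‖q_n‖ ≤ C ρ⁻ⁿ` for every `ρ < 1`
(`IsOuter.exists_toeplitz_star_eq_mono`). With `r < ρ < 1`, the series `Q(t) = ∑ a_n tⁿ q_n`
converges uniformly on `[0, r]`, is continuous, and satisfies `T_ā Q(t) = f_t`
(`exists_dilate_eq_toeplitz_star`). Hence `(f_t)⁺ = T_b̄ Q(t)` is continuous in `t`, which makes the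
integrand Bochner integrable.

The means lift too. From `∑ s_n tⁿ = f_t / (1 - t)`, integration over `[0, r]` shows that `L_r[f]`
is the average of `f_t / (1 - t)`, so `L_r[f] = T_ā q` with `q` the same average of `Q(t) / (1 -
t)`. The bounded operator `T_b̄` passes through the integral, and the formula follows.

Two facts support this: `T_ā` is injective because `a` is outer, so `f⁺` is unique; and solvability
of `T_b̄ f = T_ā g` forces `f` into `H(b)` (`mem_Hb_of_isPlus`). -/

theorem hasFPowerSeriesOnBall_of_hasSum {c : ℕ → ℂ} {F : ℂ → ℂ}
    (h : ∀ z : ℂ, ‖z‖ < 1 → HasSum (fun n => c n * z ^ n) (F z)) :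
    HasFPowerSeriesOnBall F (FormalMultilinearSeries.ofScalars ℂ c) 0 1 where
  r_le := by
    refine ENNReal.le_of_forall_nnreal_lt fun ρ hρ => ?_
    have hρ1 : ‖((ρ : ℝ) : ℂ)‖ < 1 := by
      simpa using hρ
    refine FormalMultilinearSeries.le_radius_of_summable_norm _ ?_
    refine (h _ hρ1).summable.norm.congr fun n => ?_
    simp
  r_pos := one_pos
  hasSum := by
    intro y hy
    have hy1 : ‖y‖ < 1 := by
      rw [← ENNReal.ofReal_one, Metric.eball_ofReal] at hy
      simpa using hy
    simpa [FormalMultilinearSeries.ofScalars_apply_eq, mul_comm] using h y hy1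

theorem differentiableOn_of_hasSum {c : ℕ → ℂ} {F : ℂ → ℂ}
    (h : ∀ z : ℂ, ‖z‖ < 1 → HasSum (fun n => c n * z ^ n) (F z)) :
    DifferentiableOn ℂ F (Metric.ball 0 1) := by
  have := (hasFPowerSeriesOnBall_of_hasSum h).differentiableOn
  simpa [← ENNReal.ofReal_one, Metric.eball_ofReal] using this

theorem coeff_eq_of_hasSum {c d : ℕ → ℂ} {F : ℂ → ℂ}
    (hc : ∀ z : ℂ, ‖z‖ < 1 → HasSum (fun n => c n * z ^ n) (F z))
    (hd : ∀ z : ℂ, ‖z‖ < 1 → HasSum (fun n => d n * z ^ n) (F z)) : c = d := by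
  have := (hasFPowerSeriesOnBall_of_hasSum hc).hasFPowerSeriesAt.eq_formalMultilinearSeries
    (hasFPowerSeriesOnBall_of_hasSum hd).hasFPowerSeriesAt
  exact (FormalMultilinearSeries.ofScalars_series_eq_iff ℂ c d).1 this

theorem exists_hasSum_of_differentiableOn {F : ℂ → ℂ}
    (hF : DifferentiableOn ℂ F (Metric.ball 0 1)) :
    ∃ c : ℕ → ℂ, ∀ z : ℂ, ‖z‖ < 1 → HasSum (fun n => c n * z ^ n) (F z) := by
  refine ⟨fun n => ((n.factorial : ℂ))⁻¹ * iteratedDeriv n F 0, fun z hz => ?_⟩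
  have := Complex.hasSum_taylorSeries_on_ball hF (z := z) (by simpa using hz)
  refine this.congr_fun fun n => ?_
  simp only [sub_zero, smul_eq_mul]
  ring

theorem summable_of_norm_le {c : ℕ → ℂ} {M : ℝ} (hc : ∀ n, ‖c n‖ ≤ M) {z : ℂ} (hz : ‖z‖ < 1) :
    Summable fun n => c n * z ^ n := by
  refine Summable.of_norm_bounded
    ((summable_geometric_of_lt_one (norm_nonneg z) hz).mul_left M) fun n => ?_
  rw [norm_mul, norm_pow]
  exact mul_le_mul_of_nonneg_right (hc n) (by positivity)

/-- The Cauchy product of two power series. -/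
theorem hasSum_mul_powerSeries {c d : ℕ → ℂ} {z F G : ℂ} (hc : HasSum (fun n => c n * z ^ n) F)
    (hd : HasSum (fun n => d n * z ^ n) G) :
    HasSum (fun n => (∑ p ∈ Finset.HasAntidiagonal.antidiagonal n, c p.1 * d p.2) * z ^ n)
      (F * G) := by
  have h := tsum_mul_tsum_eq_tsum_sum_antidiagonal_of_summable_norm hc.summable.norm
    hd.summable.norm
  have hs := summable_sum_mul_antidiagonal_of_summable_norm' hc.summable.norm hc.summable
    hd.summable.norm hd.summable
  rw [hc.tsum_eq, hd.tsum_eq] at h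
  rw [h]
  refine hs.hasSum.congr_fun fun n => ?_
  rw [Finset.sum_mul]
  refine Finset.sum_congr rfl fun p hp => ?_
  rw [← Finset.HasAntidiagonal.mem_antidiagonal.1 hp, pow_add]
  ring

/-! ### Fourier coefficients -/

theorem norm_fourierCoeff_le {f : Torus → ℂ} (n : ℤ) :
    ‖fourierCoeff f n‖ ≤ ∫ x, ‖f x‖ ∂arc := by
  refine (norm_integral_le_integral_norm _).trans (le_of_eq ?_)
  exact integral_congr_ae (Filter.Eventually.of_forall fun x => by
    simp only [norm_smul, fourier_apply, Circle.norm_coe, one_mul])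

theorem fourierCoeff_star (f : Torus → ℂ) (n : ℤ) :
    fourierCoeff (fun x => conj (f x)) n = conj (fourierCoeff f (-n)) := by
  simp only [fourierCoeff, ← integral_conj, smul_eq_mul, map_mul, ← fourier_neg, neg_neg]

theorem fourierCoeff_fourier_mul (f : Torus → ℂ) (m n : ℤ) :
    fourierCoeff (fun x => f x * fourier m x) n = fourierCoeff f (n - m) := by
  simp only [fourierCoeff, smul_eq_mul]
  refine integral_congr_ae (Filter.Eventually.of_forall fun x => ?_)
  have : (fourier (-(n - m)) x : ℂ) = fourier (-n) x * fourier m x := by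
    rw [← fourier_add, show -n + m = -(n - m) by omega]
  simp only [this]
  ring

theorem hasSum_discValue (g : Torus → ℂ) {z : ℂ} (hz : ‖z‖ < 1) :
    HasSum (fun n => taylorCoeff g n * z ^ n) (discValue g z) :=
  (summable_of_norm_le (fun n => norm_fourierCoeff_le (n : ℤ)) hz).hasSum

theorem differentiableOn_discValue (g : Torus → ℂ) :
    DifferentiableOn ℂ (discValue g) (Metric.ball 0 1) :=
  differentiableOn_of_hasSum fun _ hz => hasSum_discValue g hz

/-! ### The monomial basis of `H²` -/

/-- The `n`-th Taylor coefficient of an element of `H²`. -/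
def coef (g : H2) (n : ℕ) : ℂ := taylorCoeff (H2.incl g) n

/-- The monomial `z ^ n` as an element of `H²`. -/
def mono (n : ℕ) : H2 :=
  ⟨fourierLp 2 (n : ℤ), by
    intro m hm
    rw [fourierCoeff_congr_ae (coeFn_fourierLp 2 (n : ℤ)), fourierCoeff_fourier,
      Pi.single_eq_of_ne (by omega)]⟩

theorem incl_mono (n : ℕ) : H2.incl (mono n) = fourierLp 2 (n : ℤ) := rfl

theorem norm_incl (f : H2) : ‖H2.incl f‖ = ‖f‖ := rfl

theorem incl_injective : Function.Injective H2.incl := Subtype.val_injective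

theorem inner_fourierLp (n : ℤ) (g : Lp ℂ 2 arc) :
    inner ℂ (fourierLp 2 n) g = fourierCoeff g n := by
  rw [← fourierBasis_repr, fourierBasis.repr_apply_apply, coe_fourierBasis]

theorem inner_mono (n : ℕ) (g : H2) : inner ℂ (mono n) g = coef g n :=
  inner_fourierLp n (H2.incl g)

theorem fourierCoeff_incl_of_neg (g : H2) {n : ℤ} (hn : n < 0) :
    fourierCoeff (H2.incl g) n = 0 := g.2 n hn

theorem Lp_ext_fourierCoeff {f g : Lp ℂ 2 arc} (h : ∀ n, fourierCoeff f n = fourierCoeff g n) :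
    f = g := by
  apply fourierBasis.repr.injective
  ext n
  rw [fourierBasis_repr, fourierBasis_repr, h]

theorem ext_coef {f g : H2} (h : ∀ n, coef f n = coef g n) : f = g := by
  apply incl_injective
  refine Lp_ext_fourierCoeff fun n => ?_
  rcases lt_or_ge n 0 with hn | hn
  · rw [fourierCoeff_incl_of_neg f hn, fourierCoeff_incl_of_neg g hn]
  · lift n to ℕ using hn
    exact h n

theorem orthonormal_mono : Orthonormal ℂ mono := by
  have h := (orthonormal_fourier (T := 1)).comp (fun n : ℕ => (n : ℤ)) Nat.cast_injective
  rw [orthonormal_iff_ite] at h ⊢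
  exact h

/-- The monomials form a Hilbert basis of `H²`. -/
def monoBasis : HilbertBasis ℕ ℂ H2 :=
  HilbertBasis.mkOfOrthogonalEqBot orthonormal_mono (by
    rw [Submodule.eq_bot_iff]
    intro g hg
    refine ext_coef fun n => ?_
    rw [← inner_mono, ← inner_mono, inner_zero_right]
    exact hg _ (Submodule.subset_span ⟨n, rfl⟩))

theorem coe_monoBasis : ⇑monoBasis = mono :=
  HilbertBasis.coe_mkOfOrthogonalEqBot _ _

theorem monoBasis_repr (g : H2) (n : ℕ) : monoBasis.repr g n = coef g n := by
  rw [monoBasis.repr_apply_apply, coe_monoBasis, inner_mono]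

theorem coef_mono (n m : ℕ) : coef (mono n) m = if m = n then 1 else 0 := by
  rw [← inner_mono, orthonormal_iff_ite.1 orthonormal_mono]

theorem norm_mono (n : ℕ) : ‖mono n‖ = 1 := orthonormal_mono.1 n

theorem norm_coef_le (g : H2) (n : ℕ) : ‖coef g n‖ ≤ ‖g‖ := by
  rw [← inner_mono]
  simpa [norm_mono] using norm_inner_le_norm (𝕜 := ℂ) (mono n) g

@[simp] theorem coef_smul (c : ℂ) (g : H2) (n : ℕ) : coef (c • g) n = c * coef g n := by
  simp [← inner_mono]

theorem hasSum_coef_smul_mono (g : H2) : HasSum (fun n => coef g n • mono n) g := by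
  simpa only [monoBasis_repr, coe_monoBasis] using monoBasis.hasSum_repr g

/-- A square-summable sequence is the Taylor coefficient sequence of an element of `H²`. -/
theorem exists_coef_eq {c : ℕ → ℂ} (hc : Summable fun n => ‖c n‖ ^ 2) :
    ∃ g : H2, (∀ n, coef g n = c n) ∧ ‖g‖ ^ 2 = ∑' n, ‖c n‖ ^ 2 := by
  have hm : Memℓp c 2 := by
    rw [memℓp_gen_iff (by simp)]
    simpa using hc
  refine ⟨monoBasis.repr.symm ⟨c, hm⟩, fun n => ?_, ?_⟩
  · rw [← monoBasis_repr, LinearIsometryEquiv.apply_symm_apply]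
  · rw [LinearIsometryEquiv.norm_map]
    have := lp.norm_rpow_eq_tsum (p := 2) (by simp) (⟨c, hm⟩ : lp (fun _ : ℕ => ℂ) 2)
    simpa using this

/-! ### Evaluation on the disk -/

theorem hasSum_coef (g : H2) {z : ℂ} (hz : ‖z‖ < 1) :
    HasSum (fun n => coef g n * z ^ n) (discValue (H2.incl g) z) :=
  hasSum_discValue _ hz

theorem ext_discValue {f g : H2}
    (h : ∀ z : ℂ, ‖z‖ < 1 → discValue (H2.incl f) z = discValue (H2.incl g) z) : f = g := by
  refine ext_coef fun n => congrFun (coeff_eq_of_hasSum (F := discValue (H2.incl f))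
    (fun z hz => hasSum_coef f hz) fun z hz => ?_) n
  rw [h z hz]
  exact hasSum_coef g hz

theorem toH2_eq {F : ℂ → ℂ} {g : H2}
    (h : ∀ z : ℂ, ‖z‖ < 1 → discValue (H2.incl g) z = F z) : toH2 F = g := by
  have hF : ∀ z : ℂ, ‖z‖ < 1 → discValue (H2.incl (toH2 F)) z = F z :=
    Classical.epsilon_spec (p := fun g : H2 =>
      ∀ z : ℂ, ‖z‖ < 1 → discValue (H2.incl g) z = F z) ⟨g, h⟩
  exact ext_discValue fun z hz => (hF z hz).trans (h z hz).symm

/-- Evaluation at a point of the disk is a bounded functional on `H²`. -/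
theorem exists_kernel {z : ℂ} (hz : ‖z‖ < 1) :
    ∃ k : H2, ∀ g : H2, inner ℂ k g = discValue (H2.incl g) z := by
  have hs : Summable fun n => ‖conj z ^ n‖ ^ 2 := by
    have h1 : ‖z‖ ^ 2 < 1 := by
      nlinarith [norm_nonneg z]
    refine (summable_geometric_of_lt_one (by positivity) h1).congr fun n => ?_
    simp [pow_right_comm]
  obtain ⟨k, hk, -⟩ := exists_coef_eq hs
  refine ⟨k, fun g => ?_⟩
  have h := monoBasis.hasSum_inner_mul_inner k g
  rw [coe_monoBasis] at h
  refine h.unique ((hasSum_coef g hz).congr_fun ?_)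
  intro n
  rw [inner_mono, ← inner_conj_symm, inner_mono, hk]
  simp [mul_comm]

/-! ### Toeplitz operators -/

/-- Multiplication by `φ ∈ L^∞` on `L²` of the circle. -/
def mulL (φ : Lp ℂ ∞ arc) : Lp ℂ 2 arc →L[ℂ] Lp ℂ 2 arc :=
  (ContinuousLinearMap.mul ℂ ℂ).holderL arc ∞ 2 2 φ

theorem coeFn_mulL (φ : Lp ℂ ∞ arc) (g : Lp ℂ 2 arc) :
    mulL φ g =ᵐ[arc] fun x => φ x * g x :=
  (ContinuousLinearMap.mul ℂ ℂ).coeFn_holder φ g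

theorem toeplitz_apply (φ : Lp ℂ ∞ arc) (g : H2) :
    toeplitz φ g = H2.proj (mulL φ (H2.incl g)) := rfl

theorem inner_mulL_star (φ : Lp ℂ ∞ arc) (f g : Lp ℂ 2 arc) :
    inner ℂ (mulL (star φ) f) g = inner ℂ f (mulL φ g) := by
  rw [L2.inner_def, L2.inner_def]
  refine integral_congr_ae ?_
  filter_upwards [coeFn_mulL (star φ) f, coeFn_mulL φ g, Lp.coeFn_star φ] with x h1 h2 h3
  rw [h1, h2, h3]
  simp
  ring

theorem inner_proj_right (f : H2) (h : Lp ℂ 2 arc) :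
    inner ℂ f (H2.proj h) = inner ℂ (H2.incl f) h :=
  Submodule.inner_orthogonalProjectionOnto_eq_of_mem_left (K := hardy 2) f h

theorem inner_proj_left (h : Lp ℂ 2 arc) (f : H2) :
    inner ℂ (H2.proj h) f = inner ℂ h (H2.incl f) :=
  Submodule.inner_orthogonalProjectionOnto_eq_of_mem_right (K := hardy 2) f h

theorem inner_toeplitz_star (φ : Lp ℂ ∞ arc) (f g : H2) :
    inner ℂ (toeplitz (star φ) f) g = inner ℂ f (toeplitz φ g) := by
  rw [toeplitz_apply, toeplitz_apply, inner_proj_left, inner_proj_right, inner_mulL_star]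

theorem fourierCoeff_mulL_fourierLp (φ : Lp ℂ ∞ arc) (m n : ℤ) :
    fourierCoeff (mulL φ (fourierLp 2 m)) n = fourierCoeff φ (n - m) := by
  rw [← fourierCoeff_fourier_mul]
  refine congrFun (fourierCoeff_congr_ae ?_) n
  filter_upwards [coeFn_mulL φ (fourierLp 2 m), coeFn_fourierLp (T := 1) 2 m] with x h1 h2
  rw [h1, h2]

/-- Expand `g` in monomials and apply the bounded functional that takes the `n`-th coefficient of `φ
g`. -/
theorem hasSum_fourierCoeff_mulL (φ : Lp ℂ ∞ arc) (g : H2) (n : ℤ) :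
    HasSum (fun k : ℕ => coef g k * fourierCoeff φ (n - k))
      (fourierCoeff (mulL φ (H2.incl g)) n) := by
  have h := (hasSum_coef_smul_mono g).mapL
    ((innerSL ℂ (fourierLp 2 n)) ∘L (mulL φ) ∘L H2.incl)
  simp only [map_smul, ContinuousLinearMap.comp_apply, innerSL_apply_apply, incl_mono,
    inner_fourierLp, fourierCoeff_mulL_fourierLp, smul_eq_mul] at h
  exact h

theorem coef_toeplitz (φ : Lp ℂ ∞ arc) (g : H2) (n : ℕ) :
    coef (toeplitz φ g) n = fourierCoeff (mulL φ (H2.incl g)) n := by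
  rw [← inner_mono, toeplitz_apply, inner_proj_right, incl_mono, inner_fourierLp]

/-- Every convolution term involves a coefficient of `a` of negative index. Hence for analytic
symbols the projection in the Toeplitz operator does nothing. -/
theorem mulL_incl_mem (a : Hinf) (g : H2) : mulL a (H2.incl g) ∈ hardy 2 := by
  intro n hn
  refine (hasSum_fourierCoeff_mulL a g n).unique ?_
  have : (fun k : ℕ => coef g k * fourierCoeff (a : Lp ℂ ∞ arc) (n - k)) = fun _ => 0 := by
    funext k
    rw [a.2 _ (by omega), mul_zero]
  rw [this]
  exact hasSum_zero

theorem incl_toeplitz (a : Hinf) (g : H2) :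
    H2.incl (toeplitz a g) = mulL a (H2.incl g) := by
  refine Lp_ext_fourierCoeff fun n => ?_
  rcases lt_or_ge n 0 with hn | hn
  · rw [fourierCoeff_incl_of_neg _ hn, mulL_incl_mem a g n hn]
  · lift n to ℕ using hn
    exact coef_toeplitz a g n

theorem coef_toeplitz_hardy (a : Hinf) (g : H2) (n : ℕ) :
    coef (toeplitz a g) n =
      ∑ p ∈ Finset.HasAntidiagonal.antidiagonal n, taylorCoeff (a : Lp ℂ ∞ arc) p.1 * coef g p.2 := by
  rw [coef_toeplitz, ← Finset.Nat.sum_antidiagonal_swap]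
  rw [Finset.Nat.sum_antidiagonal_eq_sum_range_succ_mk]
  refine (hasSum_fourierCoeff_mulL a g n).unique ?_
  have h := hasSum_sum_of_ne_finset_zero (L := SummationFilter.unconditional ℕ)
    (f := fun k : ℕ => coef g k * fourierCoeff (a : Lp ℂ ∞ arc) ((n : ℤ) - k))
    (s := Finset.range n.succ) (by
      intro k hk
      rw [Finset.mem_range] at hk
      rw [a.2 _ (by omega), mul_zero])
  convert h using 1
  refine Finset.sum_congr rfl fun k hk => ?_
  rw [Finset.mem_range] at hk
  simp only [taylorCoeff, Prod.swap_prod_mk, mul_comm (coef g k)]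
  rw [Nat.cast_sub (by omega)]

theorem discValue_toeplitz (a : Hinf) (g : H2) {z : ℂ} (hz : ‖z‖ < 1) :
    discValue (H2.incl (toeplitz a g)) z =
      discValue (a : Lp ℂ ∞ arc) z * discValue (H2.incl g) z := by
  refine (hasSum_coef (toeplitz a g) hz).unique ?_
  simpa only [coef_toeplitz_hardy] using
    hasSum_mul_powerSeries (hasSum_discValue (a : Lp ℂ ∞ arc) hz) (hasSum_coef g hz)

theorem toeplitz_comm (a b : Hinf) (g : H2) :
    toeplitz (a : Lp ℂ ∞ arc) (toeplitz b g) = toeplitz b (toeplitz a g) := by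
  refine ext_discValue fun z hz => ?_
  rw [discValue_toeplitz a _ hz, discValue_toeplitz b _ hz, discValue_toeplitz b _ hz,
    discValue_toeplitz a _ hz]
  ring

/-- Adjoint form of `toeplitz_comm`, where both operators are multiplications on the disk. -/
theorem toeplitz_star_comm (a b : Hinf) (g : H2) :
    toeplitz (star (a : Lp ℂ ∞ arc)) (toeplitz (star (b : Lp ℂ ∞ arc)) g) =
      toeplitz (star (b : Lp ℂ ∞ arc)) (toeplitz (star (a : Lp ℂ ∞ arc)) g) := by
  refine ext_inner_right ℂ fun h => ?_
  simp only [inner_toeplitz_star, toeplitz_comm a b]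

theorem coef_toeplitz_star_mono (a : Hinf) (m n : ℕ) :
    coef (toeplitz (star (a : Lp ℂ ∞ arc)) (mono m)) n =
      if n ≤ m then conj (taylorCoeff (a : Lp ℂ ∞ arc) (m - n)) else 0 := by
  rw [coef_toeplitz, incl_mono, fourierCoeff_mulL_fourierLp,
    fourierCoeff_congr_ae (Lp.coeFn_star (a : Lp ℂ ∞ arc))]
  rw [show (star ⇑(a : Lp ℂ ∞ arc) : Torus → ℂ) = fun x => conj ((a : Lp ℂ ∞ arc) x) from rfl,
    fourierCoeff_star, neg_sub]
  split_ifs with h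
  · rw [taylorCoeff, Nat.cast_sub h]
  · rw [a.2 _ (by omega), map_zero]

/-- Analytic Toeplitz operators are plain multiplications, so this is the pointwise identity
integrated against `|g|²`. -/
theorem norm_sq_toeplitz_add {a b : Hinf}
    (h : ∀ᵐ x ∂arc, ‖(a : Lp ℂ ∞ arc) x‖ ^ 2 + ‖(b : Lp ℂ ∞ arc) x‖ ^ 2 = 1) (g : H2) :
    ‖toeplitz (a : Lp ℂ ∞ arc) g‖ ^ 2 + ‖toeplitz (b : Lp ℂ ∞ arc) g‖ ^ 2 = ‖g‖ ^ 2 := by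
  have key : ∀ f : Lp ℂ 2 arc, ‖f‖ ^ 2 = ∫ x, ‖f x‖ ^ 2 ∂arc := by
    intro f
    have h1 : (inner ℂ f f : ℂ) = ((∫ x, ‖f x‖ ^ 2 ∂arc : ℝ) : ℂ) := by
      rw [L2.inner_def, ← integral_complex_ofReal]
      exact integral_congr_ae (Filter.Eventually.of_forall fun x => by
        simp only [inner_self_eq_norm_sq_to_K]; push_cast; rfl)
    rw [inner_self_eq_norm_sq_to_K] at h1
    exact Complex.ofReal_injective (by simpa using h1)
  have hi : ∀ f : Lp ℂ 2 arc, Integrable (fun x => ‖f x‖ ^ 2) arc := fun f =>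
    (memLp_two_iff_integrable_sq_norm (Lp.aestronglyMeasurable f)).1 (Lp.memLp f)
  rw [← norm_incl, ← norm_incl, ← norm_incl, key, key, key, ← integral_add (hi _) (hi _)]
  refine integral_congr_ae ?_
  rw [incl_toeplitz, incl_toeplitz]
  filter_upwards [h, coeFn_mulL a (H2.incl g), coeFn_mulL b (H2.incl g)] with x h0 h1 h2
  rw [h1, h2, norm_mul, norm_mul, mul_pow, mul_pow, ← add_mul, h0, one_mul]

/-! ### Membership in the de Branges–Rovnyak space -/

/-- A vector `y` lies in the range of a self-adjoint operator `B` as soon as the functional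
`x ↦ ⟪y, x⟫` is bounded by a multiple of `‖B x‖`. -/
theorem mem_range_of_norm_inner_le {H : Type*} [NormedAddCommGroup H] [InnerProductSpace ℂ H]
    [CompleteSpace H] {B : H →L[ℂ] H} (hB : IsSelfAdjoint B) {y : H} {C : ℝ}
    (h : ∀ x, ‖(inner ℂ y x : ℂ)‖ ≤ C * ‖B x‖) : y ∈ LinearMap.range (B : H →ₗ[ℂ] H) := by
  have hker : LinearMap.ker (B : H →ₗ[ℂ] H).rangeRestrict ≤
      LinearMap.ker (innerSL ℂ y : H →ₗ[ℂ] ℂ) := by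
    intro x hx
    have hx' : B x = 0 := by simpa using hx
    have := h x
    rw [hx', norm_zero, mul_zero] at this
    simpa using norm_le_zero_iff.1 this
  -- The functional `B x ↦ ⟪y, x⟫`, well defined by `hker` and bounded by `C`. Extended by
  -- Hahn–Banach and represented by Riesz, it yields a vector that `B` maps to `y`.
  let L : LinearMap.range (B : H →ₗ[ℂ] H) →ₗ[ℂ] ℂ :=
    ((LinearMap.ker (B : H →ₗ[ℂ] H).rangeRestrict).liftQ (innerSL ℂ y : H →ₗ[ℂ] ℂ) hker) ∘ₗ
      ((B : H →ₗ[ℂ] H).rangeRestrict.quotKerEquivOfSurjective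
        (LinearMap.surjective_rangeRestrict _)).symm
  have hL : ∀ x : H, L ⟨B x, x, rfl⟩ = inner ℂ y x := by
    intro x
    have : ((B : H →ₗ[ℂ] H).rangeRestrict.quotKerEquivOfSurjective
        (LinearMap.surjective_rangeRestrict _)).symm ⟨B x, x, rfl⟩ =
          Submodule.Quotient.mk x := by
      rw [LinearEquiv.symm_apply_eq]
      rfl
    simp [L, this]
  let L' : StrongDual ℂ (LinearMap.range (B : H →ₗ[ℂ] H)) := L.mkContinuous C (by
    rintro ⟨_, x, rfl⟩
    exact (congrArg norm (hL x)).trans_le (h x))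
  obtain ⟨ψ, hψ, -⟩ := exists_extension_norm_eq _ L'
  refine ⟨(InnerProductSpace.toDual ℂ H).symm ψ, ext_inner_right ℂ fun x => ?_⟩
  have h1 : ψ (B x) = inner ℂ y x := (hψ ⟨B x, x, rfl⟩).trans (hL x)
  have h2 : inner ℂ (B ((InnerProductSpace.toDual ℂ H).symm ψ)) x =
      (inner ℂ ((InnerProductSpace.toDual ℂ H).symm ψ) (B x) : ℂ) :=
    hB.isSymmetric _ _
  rw [ContinuousLinearMap.coe_coe, h2, InnerProductSpace.toDual_symm_apply, h1]

/-- With `R = (I - T_b T_b̄)^{1/2}`, the functional `⟪f, ·⟫` splits into a part controlled by `R`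
and a part carried by `g`; the latter is also bounded by `‖R x‖`, so the range criterion applies. -/
theorem mem_Hb_of_isPlus {a b : Hinf}
    (h : ∀ᵐ x ∂arc, ‖(a : Lp ℂ ∞ arc) x‖ ^ 2 + ‖(b : Lp ℂ ∞ arc) x‖ ^ 2 = 1) {f g : H2}
    (hfg : IsPlus b a f g) : f ∈ Hb b := by
  set A := toeplitz (b : Lp ℂ ∞ arc) with hA
  set A' := toeplitz (star (b : Lp ℂ ∞ arc)) with hA'
  set S : H2 →L[ℂ] H2 := 1 - A * A' with hS
  have hadj : ∀ x y : H2, inner ℂ (A' x) y = (inner ℂ x (A y) : ℂ) := inner_toeplitz_star _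
  have hadj' : ∀ x y : H2, inner ℂ (A x) y = (inner ℂ x (A' y) : ℂ) := fun x y => by
    rw [← inner_conj_symm, ← hadj, inner_conj_symm]
  have hnorm := norm_sq_toeplitz_add h
  have hSx : ∀ x, S x = x - A (A' x) := fun x => rfl
  have hSsym : ∀ x y, inner ℂ (S x) y = (inner ℂ x (S y) : ℂ) := fun x y => by
    rw [hSx, hSx, inner_sub_left, inner_sub_right, hadj', hadj]
  have hAle : ∀ x, ‖A x‖ ≤ ‖x‖ := fun x => by
    refine le_of_sq_le_sq ?_ (norm_nonneg _)
    have := hnorm x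
    nlinarith [sq_nonneg ‖toeplitz (a : Lp ℂ ∞ arc) x‖]
  have hA'le : ∀ x, ‖A' x‖ ≤ ‖x‖ := fun x => by
    have h1 : ‖A' x‖ ^ 2 ≤ ‖x‖ * ‖A' x‖ := by
      rw [@norm_sq_eq_re_inner ℂ, hadj]
      refine (RCLike.re_le_norm _).trans ((norm_inner_le_norm _ _).trans ?_)
      exact mul_le_mul_of_nonneg_left (hAle _) (norm_nonneg _)
    rcases (norm_nonneg (A' x)).eq_or_lt with h0 | h0
    · rw [← h0]; exact norm_nonneg _
    · nlinarith
  have hre : ∀ x, RCLike.re (inner ℂ (S x) x : ℂ) = ‖x‖ ^ 2 - ‖A' x‖ ^ 2 := fun x => by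
    rw [hSx, inner_sub_left, hadj', map_sub, ← @norm_sq_eq_re_inner ℂ, ← @norm_sq_eq_re_inner ℂ]
  have hSpos : 0 ≤ S := by
    rw [ContinuousLinearMap.nonneg_iff_isPositive, ContinuousLinearMap.isPositive_def']
    refine ⟨?_, fun x => ?_⟩
    · rw [ContinuousLinearMap.isSelfAdjoint_iff_isSymmetric]
      exact hSsym
    · rw [ContinuousLinearMap.reApplyInnerSelf_apply, hre]
      have := hA'le x
      nlinarith [norm_nonneg (A' x)]
  set R : H2 →L[ℂ] H2 := CFC.sqrt S with hR
  have hRsa : IsSelfAdjoint R := (CFC.sqrt_nonneg S).isSelfAdjoint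
  have hRR : R * R = S := CFC.sqrt_mul_sqrt_self S hSpos
  have hRsym : ∀ x y, inner ℂ (R x) y = (inner ℂ x (R y) : ℂ) := hRsa.isSymmetric
  have hSR : ∀ x, S x = R (R x) := fun x => by rw [← hRR]; rfl
  have hRnorm : ∀ x, ‖R x‖ ^ 2 = ‖x‖ ^ 2 - ‖A' x‖ ^ 2 := fun x => by
    rw [← hre, @norm_sq_eq_re_inner ℂ, hSR, hRsym (R x) x]
  refine mem_range_of_norm_inner_le hRsa (C := ‖R f‖ + ‖g‖) fun x => ?_
  -- Write `I = R² + T_b T_b̄` and replace `T_b̄ f` by `T_ā g`.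
  have h1 : (inner ℂ f x : ℂ) = inner ℂ (R f) (R x) +
      inner ℂ g (toeplitz (a : Lp ℂ ∞ arc) (A' x)) := by
    rw [← inner_toeplitz_star, ← hfg, ← hA', hadj, ← hRsym, ← hSR, hSx, inner_sub_left, hadj',
      hadj]
    ring
  -- After `hnorm` and `hRnorm` this says `2‖A' x‖² ≤ ‖x‖² + ‖A A' x‖²`, which follows from `‖A' x‖²
  -- = Re ⟪A A' x, x⟫`, Cauchy–Schwarz and AM–GM.
  have h2 : ‖toeplitz (a : Lp ℂ ∞ arc) (A' x)‖ ≤ ‖R x‖ := by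
    refine le_of_sq_le_sq ?_ (norm_nonneg _)
    have h3 := hnorm (A' x)
    have h4 : ‖A' x‖ ^ 2 ≤ ‖A (A' x)‖ * ‖x‖ := by
      rw [@norm_sq_eq_re_inner ℂ, ← hadj']
      exact (RCLike.re_le_norm _).trans (norm_inner_le_norm _ _)
    rw [hRnorm]
    nlinarith [sq_nonneg (‖A (A' x)‖ - ‖x‖)]
  rw [h1, add_mul]
  refine (norm_add_le _ _).trans (add_le_add (norm_inner_le_norm _ _)
    ((norm_inner_le_norm _ _).trans ?_))
  exact mul_le_mul_of_nonneg_left h2 (norm_nonneg _)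

/-! ### Bounded analytic functions and Herglotz integrals -/

theorem fourier_natCast (n : ℕ) (x : Torus) : (fourier (n : ℤ) x : ℂ) = fourier 1 x ^ n := by
  induction n with
  | zero => simp
  | succ n ih => rw [Nat.cast_succ, fourier_add, ih, pow_succ]

theorem fourier_neg_natCast (n : ℕ) (x : Torus) :
    (fourier (-(n : ℤ)) x : ℂ) = (fourier 1 x ^ n)⁻¹ := by
  refine eq_inv_of_mul_eq_one_left ?_
  rw [← fourier_natCast, ← fourier_add, neg_add_cancel, fourier_zero]

/-- A bounded analytic function on the disk is an element of `H²`. -/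
theorem exists_discValue_eq_of_bounded {F : ℂ → ℂ} (hF : DifferentiableOn ℂ F (Metric.ball 0 1))
    {M : ℝ} (hM : ∀ z : ℂ, ‖z‖ < 1 → ‖F z‖ ≤ M) :
    ∃ g : H2, (∀ z : ℂ, ‖z‖ < 1 → discValue (H2.incl g) z = F z) ∧ ‖g‖ ≤ M := by
  obtain ⟨c, hc⟩ := exists_hasSum_of_differentiableOn hF
  have hM0 : 0 ≤ M := (norm_nonneg _).trans (hM 0 (by simp))
  -- Bessel's inequality for `F(ρ ·)` on the circle, a continuous function bounded by `M`. The bound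
  -- does not depend on `ρ`, so `ρ → 1` is harmless.
  have hρ : ∀ ρ ∈ Ioo (0 : ℝ) 1, ∀ s : Finset ℕ, ∑ n ∈ s, ‖c n * (ρ : ℂ) ^ n‖ ^ 2 ≤ M ^ 2 := by
    intro ρ hρ s
    have hnρ : ‖(ρ : ℂ)‖ < 1 := by
      rw [Complex.norm_real, Real.norm_of_nonneg hρ.1.le]; exact hρ.2
    have hsum : Summable fun n : ℕ =>
        (c n * (ρ : ℂ) ^ n) • (fourier (n : ℤ) : C(Torus, ℂ)) := by
      refine Summable.of_norm ((hc _ hnρ).summable.norm.congr fun n => ?_)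
      rw [norm_smul, fourier_norm, mul_one]
    set Φ := ∑' n : ℕ, (c n * (ρ : ℂ) ^ n) • (fourier (n : ℤ) : C(Torus, ℂ)) with hΦ
    have hΦM : ‖Φ‖ ≤ M := by
      rw [ContinuousMap.norm_le _ hM0]
      intro x
      have hx : ‖(ρ : ℂ) * fourier 1 x‖ < 1 := by
        rw [norm_mul, fourier_apply, Circle.norm_coe, mul_one]; exact hnρ
      have h1 := ContinuousMap.hasSum_apply hsum.hasSum x
      have h2 : Φ x = F ((ρ : ℂ) * fourier 1 x) := by
        refine h1.unique ((hc _ hx).congr_fun fun n => ?_)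
        rw [mul_pow, ContinuousMap.smul_apply, smul_eq_mul, mul_assoc, fourier_natCast]
      rw [h2]
      exact hM _ hx
    have hcoef : ∀ m : ℕ, inner ℂ (fourierLp 2 (m : ℤ)) (ContinuousMap.toLp 2 arc ℂ Φ) =
        c m * (ρ : ℂ) ^ m := by
      intro m
      have h1 := hsum.hasSum.mapL ((innerSL ℂ (fourierLp 2 (m : ℤ))) ∘L
        (ContinuousMap.toLp (E := ℂ) 2 arc ℂ))
      refine h1.unique ?_
      have h2 := hasSum_ite_eq m (c m * (ρ : ℂ) ^ m)
      refine h2.congr_fun fun n => ?_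
      have h3 := orthonormal_iff_ite.1 (orthonormal_fourier (T := 1)) (m : ℤ) (n : ℤ)
      simp only [map_smul, ContinuousLinearMap.comp_apply, innerSL_apply_apply, smul_eq_mul]
      erw [h3]
      by_cases hmn : n = m
      · simp [hmn]
      · simp [hmn, Ne.symm hmn]
    have hle : ‖ContinuousMap.toLp 2 arc ℂ Φ‖ ≤ M := by
      refine (ContinuousLinearMap.le_opNorm _ _).trans ?_
      have h1 : ‖(ContinuousMap.toLp 2 arc ℂ : C(Torus, ℂ) →L[ℂ] Lp ℂ 2 arc)‖ ≤ 1 := by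
        refine (ContinuousMap.toLp_norm_le arc).trans ?_
        simp [measureUnivNNReal]
      calc _ ≤ 1 * M := by gcongr
        _ = M := one_mul M
    have hB := (orthonormal_fourier (T := 1)).comp (fun n : ℕ => (n : ℤ)) Nat.cast_injective
      |>.sum_inner_products_le (ContinuousMap.toLp 2 arc ℂ Φ) (s := s)
    simp only [Function.comp_apply, hcoef] at hB
    exact hB.trans (pow_le_pow_left₀ (norm_nonneg _) hle 2)
  have hfin : ∀ s : Finset ℕ, ∑ n ∈ s, ‖c n‖ ^ 2 ≤ M ^ 2 := by
    intro s
    have ht : Filter.Tendsto (fun ρ : ℝ => ∑ n ∈ s, ‖c n * (ρ : ℂ) ^ n‖ ^ 2)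
        (nhdsWithin 1 (Iio 1)) (nhds (∑ n ∈ s, ‖c n‖ ^ 2)) := by
      have h1 : ∑ n ∈ s, ‖c n‖ ^ 2 = ∑ n ∈ s, ‖c n * ((1 : ℝ) : ℂ) ^ n‖ ^ 2 := by simp
      rw [h1]
      refine Filter.Tendsto.mono_left (Continuous.tendsto ?_ 1) nhdsWithin_le_nhds
      fun_prop
    refine le_of_tendsto ht ?_
    filter_upwards [Ioo_mem_nhdsLT (show (0 : ℝ) < 1 by norm_num)] with ρ h using hρ ρ h s
  have hs : Summable fun n => ‖c n‖ ^ 2 := summable_of_sum_le (fun n => by positivity) hfin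
  obtain ⟨g, hg, hgn⟩ := exists_coef_eq hs
  refine ⟨g, fun z hz => (hasSum_coef g hz).unique ?_, ?_⟩
  · simpa only [hg] using hc z hz
  · refine le_of_sq_le_sq ?_ hM0
    rw [hgn]
    exact hs.tsum_le_of_sum_le hfin

theorem coef_eq_of_discValue_eq_pow_mul {F : ℂ → ℂ}
    (hF : DifferentiableOn ℂ F (Metric.ball 0 1)) {g : H2} {k : ℕ}
    (hg : ∀ z : ℂ, ‖z‖ < 1 → discValue (H2.incl g) z = z ^ k * F z) : coef g k = F 0 := by
  obtain ⟨c, hc⟩ := exists_hasSum_of_differentiableOn hF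
  have h0 : c 0 = F 0 := by
    refine HasSum.unique ?_ (hc 0 (by simp))
    refine (hasSum_ite_eq 0 (c 0)).congr_fun fun n => ?_
    rcases eq_or_ne n 0 with rfl | hn <;> simp [*]
  have hd : ∀ z : ℂ, ‖z‖ < 1 →
      HasSum (fun n => (if n < k then 0 else c (n - k)) * z ^ n) (discValue (H2.incl g) z) := by
    intro z hz
    rw [hg z hz, ← hasSum_nat_add_iff' k, Finset.sum_eq_zero (fun i hi => by
      rw [if_pos (Finset.mem_range.1 hi), zero_mul]), sub_zero]
    refine ((hc z hz).mul_left (z ^ k)).congr_fun fun n => ?_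
    rw [if_neg (by omega), Nat.add_sub_cancel, pow_add]
    ring
  have := congrFun (coeff_eq_of_hasSum (fun z hz => hasSum_coef g hz) hd) k
  rw [this, if_neg (lt_irrefl k), Nat.sub_self, h0]

/-- The Herglotz integral `∫ (ζ + z) / (ζ - z) u(ζ) dm(ζ)`. -/
def herglotz (u : Torus → ℝ) (z : ℂ) : ℂ :=
  ∫ x, (fourier 1 x + z) / (fourier 1 x - z) * (u x : ℂ) ∂arc

theorem fourier_one_sub_ne_zero (x : Torus) {z : ℂ} (hz : ‖z‖ < 1) :
    (fourier 1 x : ℂ) - z ≠ 0 := by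
  intro h
  rw [sub_eq_zero] at h
  rw [← h, fourier_apply, Circle.norm_coe] at hz
  exact lt_irrefl _ hz

theorem integrable_herglotz {u : Torus → ℝ} (hu : Integrable u arc) {z : ℂ} (hz : ‖z‖ < 1) :
    Integrable (fun x => (fourier 1 x + z) / (fourier 1 x - z) * (u x : ℂ)) arc := by
  have hc : Continuous fun x : Torus => ((fourier 1 x : ℂ) + z) / (fourier 1 x - z) :=
    ((map_continuous (fourier 1)).add continuous_const).div
      ((map_continuous (fourier 1)).sub continuous_const) fun x => fourier_one_sub_ne_zero x hz
  obtain ⟨C, hC⟩ := isCompact_univ.exists_bound_of_continuousOn hc.continuousOn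
  exact hu.ofReal.bdd_mul hc.aestronglyMeasurable
    (Filter.Eventually.of_forall fun x => hC x (mem_univ x))

/-- Integrate `(ζ + z) / (ζ - z) = 2 ∑ (z / ζ)ⁿ - 1` termwise against `u`; the `-1` halves the
constant term. -/
theorem hasSum_herglotz {u : Torus → ℝ} (hu : Integrable u arc) {z : ℂ} (hz : ‖z‖ < 1) :
    HasSum (fun n : ℕ => ((if n = 0 then 1 else 2) *
      fourierCoeff (fun x => (u x : ℂ)) n) * z ^ n) (herglotz u z) := by
  set e : ℕ → ℂ := fun n => if n = 0 then 1 else 2 with he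
  have he2 : ∀ n, ‖e n‖ ≤ 2 := by
    intro n
    by_cases hn : n = 0 <;> simp [he, hn]
  have hker : ∀ x : Torus, HasSum (fun n : ℕ => e n * z ^ n * fourier (-(n : ℤ)) x * (u x : ℂ))
      ((fourier 1 x + z) / (fourier 1 x - z) * (u x : ℂ)) := by
    intro x
    refine HasSum.mul_right _ ?_
    have hζ : (fourier 1 x : ℂ) ≠ 0 := by simp [fourier_apply]
    have hw : ‖z / fourier 1 x‖ < 1 := by
      rw [norm_div, fourier_apply, Circle.norm_coe, div_one]; exact hz
    have h1 := ((hasSum_geometric_of_norm_lt_one hw).mul_left 2).sub (hasSum_ite_eq 0 (1 : ℂ))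
    have h2 : 2 * (1 - z / fourier 1 x)⁻¹ - 1 =
        ((fourier 1 x : ℂ) + z) / (fourier 1 x - z) := by
      have := fourier_one_sub_ne_zero x hz
      rw [one_sub_div hζ, inv_div]
      field_simp
      ring
    rw [h2] at h1
    refine h1.congr_fun fun n => ?_
    rw [fourier_neg_natCast, div_pow]
    rcases eq_or_ne n 0 with rfl | hn
    · simp [he]; norm_num
    · simp [he, hn]; ring
  have hint : ∀ n : ℕ, Integrable (fun x => e n * z ^ n * fourier (-(n : ℤ)) x * (u x : ℂ)) arc := by
    intro n
    refine (hu.ofReal.fourier_smul (-(n : ℤ))).const_mul (e n * z ^ n) |>.congr ?_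
    refine Filter.Eventually.of_forall fun x => ?_
    simp only [smul_eq_mul, mul_assoc]
    rfl
  have hnorm : Summable fun n : ℕ =>
      ∫ x, ‖e n * z ^ n * fourier (-(n : ℤ)) x * (u x : ℂ)‖ ∂arc := by
    have h1 : ∀ n : ℕ, ∫ x, ‖e n * z ^ n * fourier (-(n : ℤ)) x * (u x : ℂ)‖ ∂arc =
        ‖e n * z ^ n‖ * ∫ x, ‖u x‖ ∂arc := by
      intro n
      rw [← integral_const_mul]
      refine integral_congr_ae (Filter.Eventually.of_forall fun x => ?_)
      simp only [norm_mul, fourier_apply, Circle.norm_coe, Complex.norm_real, mul_one]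
    simp only [h1]
    exact (summable_of_norm_le he2 hz).norm.mul_right _
  have := hasSum_integral_of_summable_integral_norm hint hnorm
  simp only [(hker _).tsum_eq] at this
  refine this.congr_fun fun n => ?_
  rw [fourierCoeff, mul_right_comm, ← integral_const_mul]
  simp only [smul_eq_mul, mul_assoc, he]

theorem differentiableOn_herglotz {u : Torus → ℝ} (hu : Integrable u arc) :
    DifferentiableOn ℂ (herglotz u) (Metric.ball 0 1) :=
  differentiableOn_of_hasSum fun _ hz => hasSum_herglotz hu hz

theorem herglotz_add {u v : Torus → ℝ} (hu : Integrable u arc) (hv : Integrable v arc) {z : ℂ}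
    (hz : ‖z‖ < 1) : herglotz (fun x => u x + v x) z = herglotz u z + herglotz v z := by
  rw [herglotz, herglotz, herglotz,
    ← integral_add (integrable_herglotz hu hz) (integrable_herglotz hv hz)]
  simp only [Complex.ofReal_add, mul_add]

theorem herglotz_const (C : ℝ) {z : ℂ} (hz : ‖z‖ < 1) : herglotz (fun _ => C) z = C := by
  refine (hasSum_herglotz (integrable_const C) hz).unique ?_
  refine (hasSum_ite_eq 0 (C : ℂ)).congr_fun fun n => ?_
  have h : fourierCoeff (fun _ : Torus => (C : ℂ)) n = if n = 0 then (C : ℂ) else 0 := by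
    have h1 := fourierCoeff.const_mul (fourier 0 : C(Torus, ℂ)) (C : ℂ) n
    simp only [fourier_zero, mul_one, fourierCoeff_fourier] at h1
    rw [h1]
    rcases eq_or_ne n 0 with rfl | hn
    · simp
    · rw [if_neg hn, Pi.single_eq_of_ne (by exact_mod_cast hn), mul_zero]
  rw [h]
  rcases eq_or_ne n 0 with rfl | hn
  · simp
  · simp [hn]

theorem herglotz_zero (u : Torus → ℝ) : herglotz u 0 = ((∫ x, u x ∂arc : ℝ) : ℂ) := by
  rw [herglotz, ← integral_complex_ofReal]
  refine integral_congr_ae (Filter.Eventually.of_forall fun x => ?_)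
  have : (fourier 1 x : ℂ) ≠ 0 := by simp [fourier_apply]
  simp only [add_zero, sub_zero, div_self this, one_mul]

/-- The real part of the kernel is the Poisson kernel, which is nonnegative. -/
theorem norm_exp_herglotz_le_one {u : Torus → ℝ} (hu : Integrable u arc) (hu0 : ∀ x, u x ≤ 0)
    {z : ℂ} (hz : ‖z‖ < 1) : ‖Complex.exp (herglotz u z)‖ ≤ 1 := by
  rw [Complex.norm_exp, Real.exp_le_one_iff, herglotz]
  have h1 := integral_re (integrable_herglotz hu hz)
  simp only [RCLike.re_eq_complex_re] at h1
  rw [← h1]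
  refine integral_nonpos fun x => ?_
  simp only [Complex.re_mul_ofReal]
  refine mul_nonpos_of_nonneg_of_nonpos ?_ (hu0 x)
  have h2 : Complex.normSq (fourier 1 x) = 1 := by
    rw [Complex.normSq_eq_norm_sq, fourier_apply, Circle.norm_coe, one_pow]
  have h3 : Complex.normSq z ≤ 1 := by
    rw [Complex.normSq_eq_norm_sq]
    nlinarith [norm_nonneg z]
  rw [Complex.normSq_apply] at h2 h3
  rw [Complex.div_re, ← add_div]
  refine div_nonneg ?_ (Complex.normSq_nonneg _)
  simp only [Complex.add_re, Complex.sub_re, Complex.add_im, Complex.sub_im]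
  nlinarith

/-! ### Outer functions -/

theorem IsOuter.discValue_ne_zero {a : Hinf} (ha : IsOuter a) {z : ℂ} (hz : ‖z‖ < 1) :
    discValue (a : Lp ℂ ∞ arc) z ≠ 0 := by
  obtain ⟨c, hc, h⟩ := ha.eq_exp
  rw [h z hz]
  refine mul_ne_zero (fun h0 => ?_) (Complex.exp_ne_zero _)
  rw [h0, norm_zero] at hc
  exact zero_ne_one hc

/-- The co-analytic Toeplitz operator with outer symbol is injective. -/
theorem IsOuter.toeplitz_star_injective {a : Hinf} (ha : IsOuter a) :
    Function.Injective (toeplitz (star (a : Lp ℂ ∞ arc))) := by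
  rw [injective_iff_map_eq_zero]
  intro g hg
  refine ext_coef fun k => ?_
  obtain ⟨γ, hγ, hexp⟩ := ha.eq_exp
  set l : Torus → ℝ := fun x => Real.log ‖(a : Lp ℂ ∞ arc) x‖ with hl
  have hli : Integrable l arc := ha.integrable_log
  replace hexp : ∀ z : ℂ, ‖z‖ < 1 →
      discValue (a : Lp ℂ ∞ arc) z = γ * Complex.exp (herglotz l z) := hexp
  -- Truncated logarithms, increasing to `0`. The outer functions built on them, times `γ z^k`, are
  -- bounded multiples of `a` and tend to `γ z^k` in `H²`. Since `g` is orthogonal to the range of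
  -- `T_a`, its `k`-th coefficient vanishes.
  set w : ℕ → Torus → ℝ := fun N x => min (l x + N) 0 with hw
  have hwi : ∀ N, Integrable (w N) arc := fun N => (hli.add (integrable_const _)).inf
    (integrable_const _)
  have key : ∀ N : ℕ, ‖coef g k‖ ^ 2 ≤ ‖g‖ ^ 2 * (2 - 2 * Real.exp (∫ x, w N x ∂arc)) := by
    intro N
    set v : Torus → ℝ := fun x => min 0 (-l x - N) with hv
    have hvi : Integrable v arc := (integrable_const _).inf (hli.neg.sub (integrable_const _))
    -- Exponentiating the Herglotz integrals turns this sum into the factorisation `U = a h`; `h` is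
    -- bounded because `v ≤ 0`.
    have hvw : w N = fun x => (l x + v x) + N := by
      funext x
      simp only [hw, hv, add_min]
      rw [min_add]
      congr 1 <;> ring
    have hd : ∀ (u : Torus → ℝ), Integrable u arc →
        DifferentiableOn ℂ (fun z => Complex.exp (herglotz u z)) (Metric.ball 0 1) :=
      fun u hu => (differentiableOn_herglotz hu).cexp
    obtain ⟨h, hh, -⟩ := exists_discValue_eq_of_bounded
      (F := fun z => z ^ k * (Complex.exp N * Complex.exp (herglotz v z)))
      (((differentiable_id.pow k).differentiableOn).mul ((hd v hvi).const_mul _))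
      (M := ‖Complex.exp N‖) (fun z hz => by
        rw [norm_mul, norm_mul, norm_pow]
        have h1 := norm_exp_herglotz_le_one hvi (fun x => min_le_left _ _) hz
        have h2 : ‖z‖ ^ k ≤ 1 := pow_le_one₀ (norm_nonneg _) hz.le
        calc _ ≤ 1 * (‖Complex.exp N‖ * 1) := by gcongr
          _ = _ := by ring)
    have hdw : DifferentiableOn ℂ (fun z => γ * Complex.exp (herglotz (w N) z))
      (Metric.ball 0 1) := (hd _ (hwi N)).const_mul _
    obtain ⟨U, hU, hU1⟩ := exists_discValue_eq_of_bounded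
      (F := fun z => z ^ k * (γ * Complex.exp (herglotz (w N) z)))
      (((differentiable_id.pow k).differentiableOn).mul hdw)
      (M := 1) (fun z hz => by
        rw [norm_mul, norm_mul, norm_pow, hγ, one_mul]
        exact mul_le_one₀ (pow_le_one₀ (norm_nonneg _) hz.le) (norm_nonneg _)
          (norm_exp_herglotz_le_one (hwi N) (fun x => min_le_right _ _) hz))
    have hUh : toeplitz (a : Lp ℂ ∞ arc) h = U := by
      refine ext_discValue fun z hz => ?_
      rw [discValue_toeplitz a h hz, hh z hz, hU z hz, hexp z hz, hvw,
        herglotz_add (u := fun x => l x + v x) (hli.add hvi) (integrable_const _) hz,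
        herglotz_const _ hz, herglotz_add hli hvi hz, Complex.exp_add, Complex.exp_add]
      push_cast
      ring
    have horth : (inner ℂ g U : ℂ) = 0 := by
      rw [← hUh, ← inner_toeplitz_star, hg, inner_zero_left]
    have hcU : coef U k = γ * Complex.exp ((∫ x, w N x ∂arc : ℝ) : ℂ) := by
      rw [coef_eq_of_discValue_eq_pow_mul hdw hU, herglotz_zero]
    have hγγ : conj γ * γ = 1 := by
      rw [mul_comm, Complex.mul_conj, Complex.normSq_eq_norm_sq, hγ]; simp
    have hin : (inner ℂ (γ • mono k) U : ℂ) = ((Real.exp (∫ x, w N x ∂arc) : ℝ) : ℂ) := by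
      rw [inner_smul_left, inner_mono, hcU, ← mul_assoc, hγγ, one_mul, Complex.ofReal_exp]
    -- Expand the square: both vectors have norm at most `1`, and the cross term is known exactly.
    have hdist : ‖γ • mono k - U‖ ^ 2 ≤ 2 - 2 * Real.exp (∫ x, w N x ∂arc) := by
      rw [@norm_sub_sq ℂ, hin, norm_smul, hγ, norm_mono]
      simp only [RCLike.re_eq_complex_re, Complex.ofReal_re]
      nlinarith [norm_nonneg U]
    have hck : ‖coef g k‖ ≤ ‖g‖ * ‖γ • mono k - U‖ := by
      have h1 : ‖(inner ℂ g (γ • mono k - U) : ℂ)‖ = ‖coef g k‖ := by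
        rw [inner_sub_right, horth, sub_zero, inner_smul_right, norm_mul, hγ, one_mul,
          ← inner_conj_symm, inner_mono, RCLike.norm_conj]
      rw [← h1]
      exact norm_inner_le_norm _ _
    calc ‖coef g k‖ ^ 2 ≤ (‖g‖ * ‖γ • mono k - U‖) ^ 2 :=
          pow_le_pow_left₀ (norm_nonneg _) hck 2
      _ = ‖g‖ ^ 2 * ‖γ • mono k - U‖ ^ 2 := mul_pow _ _ _
      _ ≤ _ := mul_le_mul_of_nonneg_left hdist (sq_nonneg _)
  have hlim : Filter.Tendsto (fun N : ℕ => ∫ x, w N x ∂arc) Filter.atTop (nhds 0) := by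
    have := tendsto_integral_of_dominated_convergence (μ := arc) (F := w) (f := fun _ => 0)
      (fun x => |l x|) (fun N => (hwi N).aestronglyMeasurable) hli.abs
      (fun N => Filter.Eventually.of_forall fun x => by
        have hN : (0 : ℝ) ≤ N := N.cast_nonneg
        simp only [hw, Real.norm_eq_abs]
        rcases le_total (l x + N) 0 with h | h
        · rw [min_eq_left h, abs_of_nonpos h, abs_of_nonpos (by linarith)]
          linarith
        · rw [min_eq_right h, abs_zero]
          exact abs_nonneg _)
      (Filter.Eventually.of_forall fun x => by
        obtain ⟨N₀, hN₀⟩ := exists_nat_ge (-l x)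
        refine tendsto_const_nhds.congr' ?_
        filter_upwards [Filter.eventually_ge_atTop N₀] with N hN
        have : (N₀ : ℝ) ≤ N := by exact_mod_cast hN
        simp only [hw]
        rw [min_eq_right (by linarith)])
    simpa using this
  have hlim2 : Filter.Tendsto (fun N : ℕ => ‖g‖ ^ 2 * (2 - 2 * Real.exp (∫ x, w N x ∂arc)))
      Filter.atTop (nhds (‖g‖ ^ 2 * (2 - 2 * Real.exp 0))) :=
    ((((Real.continuous_exp.tendsto 0).comp hlim).const_mul 2).const_sub 2).const_mul _
  have hle := ge_of_tendsto' hlim2 key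
  rw [Real.exp_zero] at hle
  have h0 : coef g k = 0 := by
    have : ‖coef g k‖ ^ 2 ≤ 0 := by linarith
    simpa using le_antisymm this (sq_nonneg _)
  rw [h0, ← inner_mono, inner_zero_right]

/-- A co-analytic Toeplitz operator with outer symbol maps the span of the monomials onto itself,
with at most subexponential growth of the preimages of the monomials. -/
theorem IsOuter.exists_toeplitz_star_eq_mono {a : Hinf} (ha : IsOuter a) {ρ : ℝ}
    (hρ : ρ ∈ Ioo (0 : ℝ) 1) :
    ∃ (q : ℕ → H2) (C : ℝ), (∀ n, toeplitz (star (a : Lp ℂ ∞ arc)) (q n) = mono n) ∧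
      ∀ n, ‖q n‖ ≤ C * ρ⁻¹ ^ n := by
  obtain ⟨c, hc⟩ := exists_hasSum_of_differentiableOn
    ((differentiableOn_discValue (a : Lp ℂ ∞ arc)).inv fun z hz =>
      ha.discValue_ne_zero (by simpa using hz))
  have hconv : (fun n => ∑ p ∈ Finset.HasAntidiagonal.antidiagonal n,
      taylorCoeff (a : Lp ℂ ∞ arc) p.1 * c p.2) = fun n => if n = 0 then 1 else 0 := by
    refine coeff_eq_of_hasSum (F := fun _ => 1) (fun z hz => ?_) fun z hz => ?_
    · have h := hasSum_mul_powerSeries (hasSum_discValue (a : Lp ℂ ∞ arc) hz) (hc z hz)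
      rwa [Pi.inv_apply, mul_inv_cancel₀ (ha.discValue_ne_zero hz)] at h
    · refine (hasSum_ite_eq 0 (1 : ℂ)).congr_fun fun n => ?_
      rcases eq_or_ne n 0 with rfl | hn <;> simp [*]
  have hρn : ‖(ρ : ℂ)‖ < 1 := by
    rw [Complex.norm_real, Real.norm_of_nonneg hρ.1.le]; exact hρ.2
  have hsum : Summable fun n => ‖c n‖ * ρ ^ n := by
    refine (hc _ hρn).summable.norm.congr fun n => ?_
    rw [norm_mul, norm_pow, Complex.norm_real, Real.norm_of_nonneg hρ.1.le]
  -- Formally this is the co-analytic Toeplitz operator with symbol `conj (1/a)` applied to `z^n`;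
  -- `hconv`, the power series identity `a · (1/a) = 1`, verifies it.
  refine ⟨fun n => ∑ j ∈ Finset.range (n + 1), conj (c (n - j)) • mono j,
    ∑' n, ‖c n‖ * ρ ^ n, fun n => ext_coef fun i => ?_, fun n => ?_⟩
  · rw [map_sum, ← inner_mono, inner_sum, coef_mono]
    simp only [map_smul, inner_smul_right, inner_mono, coef_toeplitz_star_mono]
    rcases lt_or_ge n i with hi | hi
    · rw [if_neg (by omega)]
      refine Finset.sum_eq_zero fun j hj => ?_
      rw [Finset.mem_range] at hj
      rw [if_neg (by omega), mul_zero]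
    · obtain ⟨m, rfl⟩ := Nat.exists_eq_add_of_le hi
      rw [add_assoc, Finset.sum_range_add, Finset.sum_eq_zero (fun j hj => by
        rw [if_neg (by rw [Finset.mem_range] at hj; omega), mul_zero]), zero_add]
      have h := congrArg conj (congrFun hconv m)
      simp only [Finset.Nat.sum_antidiagonal_eq_sum_range_succ_mk, map_sum, map_mul] at h
      calc _ = _ := Finset.sum_congr rfl fun j _ => by
            rw [if_pos (by omega), Nat.add_sub_cancel_left, Nat.add_sub_add_left, mul_comm]
        _ = _ := h
        _ = _ := by
            by_cases hm : m = 0 <;> simp [hm]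
  · have hpos : (0 : ℝ) < ρ ^ n := pow_pos hρ.1 n
    calc ‖∑ j ∈ Finset.range (n + 1), conj (c (n - j)) • mono j‖
        ≤ ∑ j ∈ Finset.range (n + 1), ‖c (n + 1 - 1 - j)‖ :=
          norm_sum_le_of_le _ fun j _ => by
            rw [norm_smul, norm_mono, mul_one, RCLike.norm_conj, Nat.add_sub_cancel]
      _ = ∑ j ∈ Finset.range (n + 1), ‖c j‖ := Finset.sum_range_reflect (fun j => ‖c j‖) (n + 1)
      _ ≤ ∑ j ∈ Finset.range (n + 1), ‖c j‖ * ρ ^ j * ρ⁻¹ ^ n := by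
          refine Finset.sum_le_sum fun j hj => ?_
          rw [Finset.mem_range] at hj
          have h1 : ρ ^ n ≤ ρ ^ j := pow_le_pow_of_le_one hρ.1.le hρ.2.le (by omega)
          rw [inv_pow, ← div_eq_mul_inv, le_div_iff₀ hpos]
          exact mul_le_mul_of_nonneg_left h1 (norm_nonneg _)
      _ = (∑ j ∈ Finset.range (n + 1), ‖c j‖ * ρ ^ j) * ρ⁻¹ ^ n := (Finset.sum_mul _ _ _).symm
      _ ≤ _ := by
          refine mul_le_mul_of_nonneg_right ?_ (pow_nonneg (inv_nonneg.2 hρ.1.le) n)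
          exact hsum.sum_le_tsum _ fun j _ => mul_nonneg (norm_nonneg _) (pow_nonneg hρ.1.le j)

/-! ### Dilates -/

/-- The source of every `f⁺` in the proof: a lift through `T_ā` is turned into a solution by
commutation. -/
theorem isPlus_of_eq_toeplitz_star {b a : Hinf} {f q : H2}
    (h : f = toeplitz (star (a : Lp ℂ ∞ arc)) q) :
    IsPlus b a f (toeplitz (star (b : Lp ℂ ∞ arc)) q) := by
  rw [IsPlus, h, toeplitz_star_comm]

theorem IsPlus.existsUnique {b a : Hinf} (ha : IsOuter a) {f g : H2} (h : IsPlus b a f g) :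
    ∃! g : H2, IsPlus b a f g :=
  ⟨g, h, fun _ h' => ha.toeplitz_star_injective (h'.symm.trans h)⟩

theorem IsPlus.plus_eq {b a : Hinf} (ha : IsOuter a) {f g : H2} (h : IsPlus b a f g) :
    plus b a f = g :=
  (h.existsUnique ha).unique (Classical.epsilon_spec (p := fun g => IsPlus b a f g) ⟨g, h⟩) h

theorem coef_eq_of_hasSum_smul_mono {c : ℕ → ℂ} {g : H2} (h : HasSum (fun n => c n • mono n) g)
    (m : ℕ) : coef g m = c m := by
  have h1 := h.mapL (innerSL ℂ (mono m))
  simp only [innerSL_apply_apply, inner_mono] at h1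
  refine h1.unique ((hasSum_ite_eq m (c m)).congr_fun fun n => ?_)
  rw [coef_smul, coef_mono]
  by_cases hn : n = m
  · simp [hn]
  · simp [hn, Ne.symm hn]

/-- A Weierstrass majorant independent of `t`, geometric once `r < ρ`. -/
theorem norm_coef_mul_pow_smul_le (f : H2) {v : ℕ → H2} {C ρ r : ℝ}
    (hv : ∀ n, ‖v n‖ ≤ C * ρ⁻¹ ^ n) {t : ℝ} (ht : t ∈ Icc (0 : ℝ) r) (n : ℕ) :
    ‖(coef f n * (t : ℂ) ^ n) • v n‖ ≤ ‖f‖ * C * (r / ρ) ^ n := by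
  have hr : 0 ≤ r := ht.1.trans ht.2
  have h2 : 0 ≤ C * ρ⁻¹ ^ n := (norm_nonneg _).trans (hv n)
  rw [norm_smul, norm_mul, norm_pow, Complex.norm_real, Real.norm_of_nonneg ht.1]
  calc _ ≤ ‖f‖ * r ^ n * (C * ρ⁻¹ ^ n) := by
        have h1 := norm_coef_le f n
        have h3 : t ^ n ≤ r ^ n := pow_le_pow_left₀ ht.1 ht.2 n
        have h4 := pow_nonneg ht.1 n
        gcongr
        exact hv n
    _ = _ := by rw [div_eq_mul_inv, mul_pow]; ring

theorem summable_geometric_mul_div {ρ r : ℝ} (hr : 0 ≤ r) (hrρ : r < ρ) (B : ℝ) :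
    Summable fun n : ℕ => B * (r / ρ) ^ n :=
  (summable_geometric_of_lt_one (div_nonneg hr (hr.trans hrρ.le))
    ((div_lt_one (hr.trans_lt hrρ)).2 hrρ)).mul_left _

theorem summable_coef_mul_pow_smul (f : H2) {v : ℕ → H2} {C ρ r : ℝ} (hrρ : r < ρ)
    (hv : ∀ n, ‖v n‖ ≤ C * ρ⁻¹ ^ n) {t : ℝ} (ht : t ∈ Icc (0 : ℝ) r) :
    Summable fun n => (coef f n * (t : ℂ) ^ n) • v n :=
  have hr : 0 ≤ r := ht.1.trans ht.2
  (summable_geometric_mul_div hr hrρ (‖f‖ * C)).of_norm_bounded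
    (norm_coef_mul_pow_smul_le f hv ht)

theorem continuousOn_tsum_coef_mul_pow_smul (f : H2) {v : ℕ → H2} {C ρ r : ℝ} (hr : 0 ≤ r)
    (hrρ : r < ρ) (hv : ∀ n, ‖v n‖ ≤ C * ρ⁻¹ ^ n) :
    ContinuousOn (fun t : ℝ => ∑' n, (coef f n * (t : ℂ) ^ n) • v n) (Icc 0 r) :=
  continuousOn_tsum (fun n => Continuous.continuousOn (by fun_prop))
    (summable_geometric_mul_div hr hrρ (‖f‖ * C))
    fun n _ ht => norm_coef_mul_pow_smul_le f hv ht n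

theorem exists_dilate_eq_toeplitz_star {a : Hinf} (ha : IsOuter a) (f : H2) {r : ℝ}
    (hr : r ∈ Ioo (0 : ℝ) 1) :
    ∃ Q : ℝ → H2, ContinuousOn Q (Icc 0 r) ∧ ∀ t ∈ Icc (0 : ℝ) r, ∀ z : ℂ, ‖z‖ < 1 →
      discValue (H2.incl (toeplitz (star (a : Lp ℂ ∞ arc)) (Q t))) z = dilate f t z := by
  obtain ⟨ρ, hrρ, hρ1⟩ := exists_between hr.2
  obtain ⟨q, C, hq, hqC⟩ := ha.exists_toeplitz_star_eq_mono ⟨hr.1.trans hrρ, hρ1⟩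
  refine ⟨fun t => ∑' n, (coef f n * (t : ℂ) ^ n) • q n,
    continuousOn_tsum_coef_mul_pow_smul f hr.1.le hrρ hqC, fun t ht z hz => ?_⟩
  have h := (summable_coef_mul_pow_smul f hrρ hqC ht).hasSum.mapL
    (toeplitz (star (a : Lp ℂ ∞ arc)))
  simp only [map_smul, hq] at h
  rw [← (hasSum_coef _ hz).tsum_eq]
  simp only [coef_eq_of_hasSum_smul_mono h]
  rfl

/-! ### Logarithmic means -/

/-- Cauchy product in the variable `t` with the geometric series, which sums coefficients. -/
theorem hasSum_partialSum (f : H2) {z : ℂ} (hz : ‖z‖ < 1) {t : ℝ} (ht : ‖t‖ < 1) :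
    HasSum (fun n => partialSum f n z * (t : ℂ) ^ n) ((1 - (t : ℂ))⁻¹ * dilate f t z) := by
  have ht' : ‖(t : ℂ)‖ < 1 := by rwa [Complex.norm_real]
  have h1 : HasSum (fun n => (fun _ : ℕ => (1 : ℂ)) n * (t : ℂ) ^ n) (1 - (t : ℂ))⁻¹ := by
    simpa using hasSum_geometric_of_norm_lt_one ht'
  have htz : ‖(t : ℂ) * z‖ < 1 := by
    rw [norm_mul]
    exact mul_lt_one_of_nonneg_of_lt_one_left (norm_nonneg _) ht' hz.le
  have h2 : HasSum (fun n => (coef f n * z ^ n) * (t : ℂ) ^ n) (dilate f t z) := by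
    have h3 := (hasSum_coef f htz).summable.hasSum
    have h4 : (fun n => (coef f n * z ^ n) * (t : ℂ) ^ n) =
        fun n => coef f n * ((t : ℂ) * z) ^ n := by
      funext n; rw [mul_pow]; ring
    have h5 : dilate f t z = ∑' n, coef f n * ((t : ℂ) * z) ^ n :=
      tsum_congr fun n => by rw [mul_pow, ← mul_assoc]; rfl
    rwa [h4, h5]
  refine (hasSum_mul_powerSeries h1 h2).congr_fun fun n => ?_
  congr 1
  rw [← Finset.Nat.sum_antidiagonal_swap, Finset.Nat.sum_antidiagonal_eq_sum_range_succ_mk]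
  simp only [Prod.swap_prod_mk, one_mul]
  rfl

theorem norm_partialSum_le (f : H2) {z : ℂ} (hz : ‖z‖ < 1) (n : ℕ) :
    ‖partialSum f n z‖ ≤ ∑' k, ‖coef f k * z ^ k‖ :=
  (norm_sum_le _ _).trans
    ((hasSum_coef f hz).summable.norm.sum_le_tsum _ fun _ _ => norm_nonneg _)

/-- Termwise integration of `hasSum_partialSum` produces `r^(n+1) / (n+1)`; the surplus power of `r`
is the factor `r` in front of `logMean`. -/
theorem hasSum_partialSum_integral (f : H2) {z : ℂ} (hz : ‖z‖ < 1) {r : ℝ}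
    (hr : r ∈ Ioo (0 : ℝ) 1) :
    HasSum (fun n : ℕ => partialSum f n z / ((n : ℂ) + 1) * (r : ℂ) ^ n)
      ((r : ℂ)⁻¹ * ∫ t in (0 : ℝ)..r, (1 - (t : ℂ))⁻¹ * dilate f t z) := by
  set B := ∑' k, ‖coef f k * z ^ k‖ with hB
  have hB0 : 0 ≤ B := tsum_nonneg fun _ => norm_nonneg _
  have h := intervalIntegral.hasSum_integral_of_dominated_convergence (μ := volume)
    (a := 0) (b := r) (F := fun n t => partialSum f n z * (t : ℂ) ^ n)
    (f := fun t => (1 - (t : ℂ))⁻¹ * dilate f t z) (fun n _ => B * r ^ n)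
    (fun n => Continuous.aestronglyMeasurable (by fun_prop))
    (fun n => Filter.Eventually.of_forall fun t ht => by
      rw [uIoc_of_le hr.1.le] at ht
      rw [norm_mul, norm_pow, Complex.norm_real, Real.norm_of_nonneg ht.1.le]
      have h1 := norm_partialSum_le f hz n
      have h2 : t ^ n ≤ r ^ n := pow_le_pow_left₀ ht.1.le ht.2 n
      have h3 := pow_nonneg ht.1.le n
      gcongr)
    (Filter.Eventually.of_forall fun t _ =>
      (summable_geometric_of_lt_one hr.1.le hr.2).mul_left B)
    intervalIntegrable_const
    (Filter.Eventually.of_forall fun t ht => by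
      rw [uIoc_of_le hr.1.le] at ht
      refine hasSum_partialSum f hz ?_
      rw [Real.norm_of_nonneg ht.1.le]
      exact ht.2.trans_lt hr.2)
  have hr0 : (r : ℂ) ≠ 0 := by exact_mod_cast hr.1.ne'
  refine (h.mul_left (r : ℂ)⁻¹).congr_fun fun n => ?_
  have h1 : ∫ t in (0 : ℝ)..r, (t : ℂ) ^ n = (r : ℂ) ^ (n + 1) / ((n : ℂ) + 1) := by
    have := integral_pow (a := 0) (b := r) n
    have h2 : ∫ t in (0 : ℝ)..r, (t : ℂ) ^ n = ((∫ t in (0 : ℝ)..r, t ^ n : ℝ) : ℂ) := by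
      rw [← intervalIntegral.integral_ofReal]
      push_cast
      rfl
    rw [h2, this]
    push_cast
    simp
  rw [intervalIntegral.integral_const_mul, h1]
  field_simp
  ring

/-- Point evaluation is a bounded functional, so it commutes with the Bochner integral. This links
the scalar identity for `logMean` to the `H²`-valued one. -/
theorem discValue_integral {D : ℝ → H2} {r : ℝ} (hD : IntervalIntegrable D volume 0 r) {z : ℂ}
    (hz : ‖z‖ < 1) :
    discValue (H2.incl (∫ t in (0 : ℝ)..r, D t)) z =
      ∫ t in (0 : ℝ)..r, discValue (H2.incl (D t)) z := by
  obtain ⟨k, hk⟩ := exists_kernel hz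
  rw [← hk, ← innerSL_apply_apply ℂ, ← ContinuousLinearMap.intervalIntegral_comp_comm _ hD]
  simp only [innerSL_apply_apply, hk]

theorem discValue_real_smul (s : ℝ) (g : H2) {z : ℂ} (hz : ‖z‖ < 1) :
    discValue (H2.incl (s • g)) z = s * discValue (H2.incl g) z := by
  obtain ⟨k, hk⟩ := exists_kernel hz
  rw [← hk, ← hk, ← Complex.coe_smul, inner_smul_right]

end DeBrangesRovnyak

end

/-! ### The integral formula for the logarithmic means -/

theorem theorem4p4 (b a : DeBrangesRovnyak.Hinf) (hb : DeBrangesRovnyak.NonExtreme b)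
    (hab : DeBrangesRovnyak.IsPythagoreanPair b a)
    (f : DeBrangesRovnyak.H2) (hf : f ∈ DeBrangesRovnyak.Hb b)
    (r : ℝ) (hr : r ∈ Set.Ioo (0 : ℝ) 1) :
    -- for `t ∈ [0, r]` the dilate `f_t` is in `H(b)`, and `(f_t)⁺` is well defined
    (∀ t ∈ Set.Icc (0 : ℝ) r,
      DeBrangesRovnyak.MemH2 (DeBrangesRovnyak.dilate f t) ∧
      DeBrangesRovnyak.toH2 (DeBrangesRovnyak.dilate f t) ∈ DeBrangesRovnyak.Hb b ∧
      ∃! g : DeBrangesRovnyak.H2,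
        DeBrangesRovnyak.IsPlus b a (DeBrangesRovnyak.toH2 (DeBrangesRovnyak.dilate f t)) g) ∧
    -- the series defining `L_r[f]` converges on the disk, `L_r[f]` is in `H(b)`, and `(L_r[f])⁺`
    -- is well defined
    (∀ z : ℂ, ‖z‖ < 1 → Summable fun n : ℕ =>
      DeBrangesRovnyak.partialSum f n z / ((n : ℂ) + 1) * (r : ℂ) ^ n) ∧
    DeBrangesRovnyak.MemH2 (DeBrangesRovnyak.logMean f r) ∧
    DeBrangesRovnyak.toH2 (DeBrangesRovnyak.logMean f r) ∈ DeBrangesRovnyak.Hb b ∧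
    (∃! g : DeBrangesRovnyak.H2,
      DeBrangesRovnyak.IsPlus b a (DeBrangesRovnyak.toH2 (DeBrangesRovnyak.logMean f r)) g) ∧
    -- the integrand is Bochner integrable in `H²`, and the formula holds
    IntervalIntegrable (fun t : ℝ => (1 - t)⁻¹ •
        DeBrangesRovnyak.plus b a (DeBrangesRovnyak.toH2 (DeBrangesRovnyak.dilate f t)))
      MeasureTheory.volume 0 r ∧
    DeBrangesRovnyak.plus b a (DeBrangesRovnyak.toH2 (DeBrangesRovnyak.logMean f r)) =
      (Real.log (1 / (1 - r)))⁻¹ • ∫ t in (0 : ℝ)..r, (1 - t)⁻¹ •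
        DeBrangesRovnyak.plus b a (DeBrangesRovnyak.toH2 (DeBrangesRovnyak.dilate f t)) := by
  open DeBrangesRovnyak in
  have ha : IsOuter a := hab.outer
  obtain ⟨Q, hQc, hQ⟩ := exists_dilate_eq_toeplitz_star ha f hr
  set A := toeplitz (star (a : Lp ℂ ∞ arc)) with hA
  set B := toeplitz (star (b : Lp ℂ ∞ arc)) with hB
  have hdil : ∀ t ∈ Set.Icc (0 : ℝ) r, toH2 (dilate f t) = A (Q t) := fun t ht =>
    toH2_eq (hQ t ht)
  have hplus : ∀ t ∈ Set.Icc (0 : ℝ) r, IsPlus b a (toH2 (dilate f t)) (B (Q t)) :=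
    fun t ht => isPlus_of_eq_toeplitz_star (hdil t ht)
  have hab1 := hab.sq_add_sq
  have hIcc : Set.uIcc 0 r = Set.Icc 0 r := Set.uIcc_of_le hr.1.le
  have hinv : ContinuousOn (fun t : ℝ => (1 - t)⁻¹) (Set.uIcc 0 r) := by
    rw [hIcc]
    exact (continuousOn_const.sub continuousOn_id).inv₀ fun t ht =>
      (sub_pos.2 (ht.2.trans_lt hr.2)).ne'
  have hint : IntervalIntegrable (fun t : ℝ => (1 - t)⁻¹ • Q t) MeasureTheory.volume 0 r :=
    (hinv.smul (hIcc ▸ hQc)).intervalIntegrable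
  -- Used with `L = A` to recover `L_r[f]` and with `L = B` to obtain `(L_r[f])⁺`.
  have hcomp : ∀ L : H2 →L[ℂ] H2,
      IntervalIntegrable (fun t : ℝ => (1 - t)⁻¹ • L (Q t)) MeasureTheory.volume 0 r ∧
      ∫ t in (0 : ℝ)..r, (1 - t)⁻¹ • L (Q t) = L (∫ t in (0 : ℝ)..r, (1 - t)⁻¹ • Q t) := by
    intro L
    refine ⟨(hinv.smul (L.continuous.comp_continuousOn (hIcc ▸ hQc))).intervalIntegrable, ?_⟩
    rw [← L.intervalIntegral_comp_comm hint]
    simp only [L.map_smul_of_tower]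
  set s : ℝ := (Real.log (1 / (1 - r)))⁻¹ with hs
  have hlog : ∀ z : ℂ, ‖z‖ < 1 →
      discValue (H2.incl (A (s • ∫ t in (0 : ℝ)..r, (1 - t)⁻¹ • Q t))) z = logMean f r z := by
    intro z hz
    rw [A.map_smul_of_tower, ← (hcomp A).2, discValue_real_smul _ _ hz,
      discValue_integral (hcomp A).1 hz, logMean, (hasSum_partialSum_integral f hz hr).tsum_eq]
    have h1 : ∫ t in (0 : ℝ)..r, discValue (H2.incl ((1 - t)⁻¹ • A (Q t))) z =
        ∫ t in (0 : ℝ)..r, (1 - (t : ℂ))⁻¹ * dilate f t z := by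
      refine intervalIntegral.integral_congr fun t ht => ?_
      rw [hIcc] at ht
      simp only [discValue_real_smul _ _ hz, hQ t ht z hz]
      push_cast
      rfl
    have hr0 : (r : ℂ) ≠ 0 := by exact_mod_cast hr.1.ne'
    rw [h1, ← mul_assoc]
    congr 1
    rw [hs]
    push_cast
    field_simp
  have hlogH : toH2 (logMean f r) = A (s • ∫ t in (0 : ℝ)..r, (1 - t)⁻¹ • Q t) := toH2_eq hlog
  have hlogp : IsPlus b a (toH2 (logMean f r)) (B (s • ∫ t in (0 : ℝ)..r, (1 - t)⁻¹ • Q t)) :=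
    isPlus_of_eq_toeplitz_star hlogH
  -- `plus` is identified only for `t` in `[0, r]`, which is all that the interval integral sees.
  have heq : ∀ t ∈ Set.Icc (0 : ℝ) r,
      (1 - t)⁻¹ • B (Q t) = (1 - t)⁻¹ • plus b a (toH2 (dilate f t)) := fun t ht => by
    rw [(hplus t ht).plus_eq ha]
  refine ⟨fun t ht => ⟨⟨_, hQ t ht⟩, mem_Hb_of_isPlus hab1 (hplus t ht),
    (hplus t ht).existsUnique ha⟩, fun z hz => (hasSum_partialSum_integral f hz hr).summable,
    ⟨_, hlog⟩, mem_Hb_of_isPlus hab1 hlogp, hlogp.existsUnique ha,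
    (hcomp B).1.congr fun t ht => heq t ?_, ?_⟩
  · rw [Set.uIoc_of_le hr.1.le] at ht
    exact Set.Ioc_subset_Icc_self ht
  · rw [hlogp.plus_eq ha, B.map_smul_of_tower, ← (hcomp B).2]
    congr 1
    exact intervalIntegral.integral_congr fun t ht => heq t (hIcc ▸ ht)
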